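/- Setting. Let $U\subset\mathbb R^3$ be a non-empty open set with coordinates $q=(x,v,D)$, let $\varepsilon_0>0$ and $\mathbb T=\mathbb R/2\pi\mathbb Z$. A near-integrable two-degrees-of-freedom Hamiltonian system is a family $$H(x,v,D,\theta;\varepsilon)=H_0(x,v,D)+\varepsilon H_1(x,v,D,\theta;\varepsilon),\qquad (x,v,D)\in U,\ \theta\in\mathbb T,\ |\varepsilon|<\varepsilon_0,$$ with $H_0$, $H_1$ of class $C^\infty$ and equations $\dot x=\partial_vH$, $\dot v=-\partial_xH$, $\dot\theta=\partial_DH$, $\dot D=-\partial_\theta H$. The space $\mathcal N$ of all pairs $(H_0,H_1)$ carries the weak $C^\infty$ topology (uniform convergence of all derivatives on compact sets). A point $q\in U$ gives a circle of fixed points of $H_0$ if every point of $\{q\}\times\mathbb T$ is a fixed point of the flow of $H_0$, i.e. $\partial_xH_0(q)=\partial_vH_0(q)=\partial_DH_0(q)=0$. The circle is normally hyperbolic (respectively normally elliptic) if the linearization at $(x,v)$ of the planar flow $\dot x=\partial_vH_0$, $\dot v=-\partial_xH_0$ ($D$ fixed) has no eigenvalue on the imaginary axis (respectively only non-zero, purely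 imaginary eigenvalues). It is transverse if $d(\partial_xH_0)$, $d(\partial_vH_0)$, $d(\partial_DH_0)$ are linearly independent at $q$, i.e. the curve of fixed points $\{\partial_xH_0=\partial_vH_0=0\}$ crosses the surface $\{\partial_DH_0=0\}$, where $\dot\theta=0$, transversely. The system has a hyperbolic (respectively elliptic) resonance at $q$ if $q$ gives a normally hyperbolic (respectively elliptic) circle of fixed points of $H_0$ and this circle is perturbed, i.e. $\theta\mapsto H_1(q,\theta;0)$ is not constant. Corollary 2. The occurrence of hyperbolic (respectively elliptic) resonances is generic in near-integrable two-degrees-of-freedom Hamiltonian systems, in the following sense. 1. For every compact $K\subset U$, the systems in $\mathcal N$ for which each circle of fixed points $q\in K$ of $H_0$ is transverse and is either a hyperbolic or an elliptic resonance form an open dense subset of $\mathcal N$. 2. For each of the two types, hyperbolic and elliptic: (a) the set of systems in $\mathcal N$ that have a resonance of this type has dense interior in $\mathcal N$; (b) for every open $V$ meeting $U$, the set of systems in $\mathcal N$ that have a resonance of this type at some $q\in V$ has non-empty interior; (c) if a system has a resonance of this type at $q$ and the circle is transverse, then every neighbourhood of $q$ contains a neighbourhood $V$ of $q$ such that every system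 sufficiently close to the given one in $\mathcal N$ has exactly one circle of fixed points of its integrable part in $V$, and this circle is transverse and again a resonance of the same type. -/

import Mathlib

open Set Filter Topology
open scoped ContDiff

noncomputable section

namespace Resonance

/-! ### Smooth functions on an open set, with the weak (compact-open) smooth topology -/

/-- Functions that are infinitely differentiable on `W`.  Only the values on `W` matter: the
topology below does not see the values elsewhere. -/
def SmoothOn {E : Type*} [NormedAddCommGroup E] [NormedSpace ℝ E] (W : Set E) : Type _ :=
  {f : E → ℝ // ContDiffOn ℝ ∞ f W}

/-- The weak smooth topology on functions on an open set `W`: uniform convergence of the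
derivatives of every order on every compact subset of `W`. -/
instance {E : Type*} [NormedAddCommGroup E] [NormedSpace ℝ E] (W : Set E) :
    TopologicalSpace (SmoothOn W) :=
  ⨅ k : ℕ, TopologicalSpace.induced
    (fun f : SmoothOn W =>
      UniformOnFun.ofFun {K : Set E | IsCompact K ∧ K ⊆ W} (iteratedFDeriv ℝ k f.1))
    inferInstance

/-! ### Two-degrees-of-freedom Hamiltonian systems -/

/-- The variables `q = (x, v, D)`. -/
abbrev Base : Type := ℝ × ℝ × ℝ

/-- Phase space points `(q, θ) = ((x, v, D), θ)`; the angle `θ` is understood modulo `2π`. -/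
abbrev Phase : Type := Base × ℝ

/-- The Hamiltonian vector field of `K` for the symplectic form `dx ∧ dv + dθ ∧ dD`:
`x' = ∂K/∂v`, `v' = -∂K/∂x`, `D' = -∂K/∂θ`, `θ' = ∂K/∂D`. -/
def hamiltonianField (K : Phase → ℝ) (z : Phase) : Phase :=
  ((fderiv ℝ K z ((0, 1, 0), 0), -fderiv ℝ K z ((1, 0, 0), 0), -fderiv ℝ K z ((0, 0, 0), 1)),
    fderiv ℝ K z ((0, 0, 1), 0))

/-- The circle `{q} × 𝕋` consists of fixed points of the Hamiltonian flow of `K`. -/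
def IsCircleOfFixedPoints (K : Phase → ℝ) (q : Base) : Prop :=
  ∀ θ : ℝ, hamiltonianField K (q, θ) = 0

/-- Partial derivative in `x`. -/
def pdx (H : Base → ℝ) (q : Base) : ℝ := fderiv ℝ H q (1, 0, 0)

/-- Partial derivative in `v`. -/
def pdv (H : Base → ℝ) (q : Base) : ℝ := fderiv ℝ H q (0, 1, 0)

/-- Partial derivative in `D`. -/
def pdD (H : Base → ℝ) (q : Base) : ℝ := fderiv ℝ H q (0, 0, 1)

/-- The integrable Hamiltonian on phase space, independent of `θ`, given by `H₀(x, v, D)`. -/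
def lift (H₀ : Base → ℝ) : Phase → ℝ := fun z => H₀ z.1

/-- The linearization, at `q = (x, v, D)`, of the flow `x' = ∂H₀/∂v`, `v' = -∂H₀/∂x` in the
`(x, v)` plane, with `D` fixed. -/
def planarJacobian (H₀ : Base → ℝ) (q : Base) : Matrix (Fin 2) (Fin 2) ℝ :=
  !![pdx (pdv H₀) q, pdv (pdv H₀) q;
    -pdx (pdx H₀) q, -pdv (pdx H₀) q]

/-- A normally hyperbolic circle of fixed points of the integrable system `H₀`: the fixed point
in the `(x, v)` plane is hyperbolic (no eigenvalue on the imaginary axis). -/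
def IsNormallyHyperbolicCircle (H₀ : Base → ℝ) (q : Base) : Prop :=
  IsCircleOfFixedPoints (lift H₀) q ∧
    ∀ μ ∈ spectrum ℂ ((planarJacobian H₀ q).map (algebraMap ℝ ℂ)), μ.re ≠ 0

/-- A normally elliptic circle of fixed points of the integrable system `H₀`: the fixed point
in the `(x, v)` plane is elliptic (the eigenvalues are non-zero and purely imaginary). -/
def IsNormallyEllipticCircle (H₀ : Base → ℝ) (q : Base) : Prop :=
  IsCircleOfFixedPoints (lift H₀) q ∧
    ∀ μ ∈ spectrum ℂ ((planarJacobian H₀ q).map (algebraMap ℝ ℂ)), μ.re = 0 ∧ μ ≠ 0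

/-- The set `∂H₀/∂x = ∂H₀/∂v = 0` of fixed points of the planar flows is, at `q`, a smooth curve,
the set `∂H₀/∂D = 0` (where `θ' = 0`) is a smooth surface, and they intersect transversely:
the three differentials of the defining functions are linearly independent. -/
def IsTransverse (H₀ : Base → ℝ) (q : Base) : Prop :=
  LinearIndependent ℝ ![fderiv ℝ (pdx H₀) q, fderiv ℝ (pdv H₀) q, fderiv ℝ (pdD H₀) q]

/-! ### Near-integrable systems and resonances -/

/-- Perturbations `H₁(x, v, D, θ; ε)`, smooth for `(x, v, D) ∈ U`, `θ ∈ 𝕋`, `|ε| < ε₀`;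
the angle is represented by `2π`-periodicity. -/
def Perturbation (U : Set Base) (ε₀ : ℝ) : Type :=
  {f : SmoothOn (U ×ˢ (univ : Set ℝ) ×ˢ Ioo (-ε₀) ε₀) //
    ∀ q ∈ U, ∀ θ : ℝ, ∀ ε ∈ Ioo (-ε₀) ε₀, f.1 (q, θ + 2 * Real.pi, ε) = f.1 (q, θ, ε)}

instance (U : Set Base) (ε₀ : ℝ) : TopologicalSpace (Perturbation U ε₀) :=
  instTopologicalSpaceSubtype

/-- Near-integrable Hamiltonians `H₀(x, v, D) + ε H₁(x, v, D, θ; ε)` on `U × 𝕋`, given by the pair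
`(H₀, H₁)`; the space of them carries the product topology. -/
abbrev NearIntegrable (U : Set Base) (ε₀ : ℝ) : Type :=
  SmoothOn U × Perturbation U ε₀

namespace NearIntegrable

variable {U : Set Base} {ε₀ : ℝ}

/-- The integrable part `H₀`. -/
def unperturbed (N : NearIntegrable U ε₀) : Base → ℝ := N.1.1

/-- The Hamiltonian `H₀ + ε H₁(·; ε)` on phase space. -/
def hamiltonian (N : NearIntegrable U ε₀) (ε : ℝ) : Phase → ℝ :=
  fun z => N.1.1 z.1 + ε * N.2.1.1 (z.1, z.2, ε)

/-- The perturbation acts on the circle `{q} × 𝕋`: to first order in `ε`, it drives some of its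
points in the direction of `D` (that is, `θ ↦ H₁(q, θ; 0)` is not constant). -/
def PerturbsCircle (N : NearIntegrable U ε₀) (q : Base) : Prop :=
  ∃ θ : ℝ, deriv (fun ε : ℝ => (hamiltonianField (N.hamiltonian ε) (q, θ)).1.2.2) 0 ≠ 0

/-- A hyperbolic resonance at `q`: a normally hyperbolic circle of fixed points of the integrable
system, perturbed. -/
def IsHyperbolicResonance (N : NearIntegrable U ε₀) (q : Base) : Prop :=
  q ∈ U ∧ IsNormallyHyperbolicCircle N.unperturbed q ∧ N.PerturbsCircle q

/-- An elliptic resonance at `q`: a normally elliptic circle of fixed points of the integrable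
system, perturbed. -/
def IsEllipticResonance (N : NearIntegrable U ε₀) (q : Base) : Prop :=
  q ∈ U ∧ IsNormallyEllipticCircle N.unperturbed q ∧ N.PerturbsCircle q

end NearIntegrable

/-- Every circle of fixed points in `K` of the integrable system becomes a hyperbolic or an elliptic
resonance, and is a transverse intersection of the curve of fixed points with `θ' = 0`. -/
def OnlySimpleResonances {U : Set Base} {ε₀ : ℝ} (K : Set Base) (N : NearIntegrable U ε₀) : Prop :=
  ∀ q ∈ K, IsCircleOfFixedPoints (lift N.unperturbed) q →
    (N.IsHyperbolicResonance q ∨ N.IsEllipticResonance q) ∧ IsTransverse N.unperturbed q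

/-- The occurrence of the phenomenon `R` (a property of systems and of points `q`) is generic, that
is, of codimension zero:
* the systems that exhibit it robustly are dense (and form an open set);
* near any place of `U` it occurs for all systems of some non-empty open set;
* where it occurs at a transverse intersection, it persists: all nearby systems have, close to the
  given circle, exactly one circle of fixed points, it exhibits `R`, and it is again transverse. -/
def OccursGenerically (U : Set Base) (ε₀ : ℝ) (R : NearIntegrable U ε₀ → Base → Prop) : Prop :=
  Dense (interior {N : NearIntegrable U ε₀ | ∃ q, R N q}) ∧
  (∀ V : Set Base, IsOpen V → (V ∩ U).Nonempty →
    (interior {N : NearIntegrable U ε₀ | ∃ q ∈ V, R N q}).Nonempty) ∧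
  (∀ (N : NearIntegrable U ε₀) (q : Base), R N q → IsTransverse N.unperturbed q →
    ∀ W ∈ 𝓝 q, ∃ V ∈ 𝓝 q, V ⊆ W ∧ ∀ᶠ N' in 𝓝 N,
      ∃ q' ∈ V, R N' q' ∧ IsTransverse N'.unperturbed q' ∧
        ∀ q'' ∈ V, IsCircleOfFixedPoints (lift N'.unperturbed) q'' → q'' = q')

end Resonance

end

noncomputable section

namespace Resonance

/-! ### The weak smooth topology -/

namespace SmoothOn

variable {E : Type*} [NormedAddCommGroup E] [NormedSpace ℝ E] {W : Set E}

/-! Everything is read off the gradient map `grad` of the integrable part, a map from `U` to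
three-space. Its zeros are the circles of fixed points, and transversality is invertibility of its
derivative `gradDeriv`. The planar linearization is traceless, so its eigenvalues satisfy `μ ^ 2 +
planarDet = 0` and the type is the sign of `planarDet`. The circle is perturbed iff the θ-derivative
of `H₁` at `ε = 0` does not vanish identically on it.

These conditions are jointly open in the system and the point. Compactness of `K` then gives
openness in part 1, and a quantitative inverse function theorem
(`eventually_existsUnique_grad_eq_zero`) gives persistence.

For density in part 1, a small multiple of `(x² + v²) / 2` makes the zero set of `planarDet` null,
by Fubini. The gradient maps that null set and its own critical points (Sard) to null sets, so
adding a small generic linear form moves all zeros off both (`mem_closure_nondegenerateSystems`).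
The zeros are now isolated, hence countable, and a small `δ cos θ` with `δ` off a countable set
perturbs every circle.

For part 2, the weak topology ignores what happens outside a compact set, and `U` is not compact: a
quadratic model with a critical point of either type can be glued in near the edge of `U`.
Persistence makes the resulting resonances robust. -/

theorem tendsto_nhds_iff {ι : Type*} {l : Filter ι} {F : ι → SmoothOn W} {f : SmoothOn W} :
    Tendsto F l (𝓝 f) ↔ ∀ k : ℕ, ∀ K : Set E, IsCompact K → K ⊆ W →
      TendstoUniformlyOn (fun i => iteratedFDeriv ℝ k (F i).1) (iteratedFDeriv ℝ k f.1) l K := by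
  have h : 𝓝 f = ⨅ k : ℕ, comap (fun f : SmoothOn W =>
      UniformOnFun.ofFun {K : Set E | IsCompact K ∧ K ⊆ W} (iteratedFDeriv ℝ k f.1))
      (𝓝 (UniformOnFun.ofFun {K : Set E | IsCompact K ∧ K ⊆ W} (iteratedFDeriv ℝ k f.1))) := by
    refine (nhds_iInf (t := fun k : ℕ => TopologicalSpace.induced (fun f : SmoothOn W =>
      UniformOnFun.ofFun {K : Set E | IsCompact K ∧ K ⊆ W} (iteratedFDeriv ℝ k f.1))
        inferInstance) (a := f)).trans ?_
    simp only [nhds_induced]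
  rw [h, tendsto_iInf]
  refine forall_congr' fun k => ?_
  rw [tendsto_comap_iff, UniformOnFun.tendsto_iff_tendstoUniformlyOn]
  exact ⟨fun h K h1 h2 => h K ⟨h1, h2⟩, fun h K hK => h K hK.1 hK.2⟩

theorem contDiffAt (hW : IsOpen W) (f : SmoothOn W) {x : E} (hx : x ∈ W) :
    ContDiffAt ℝ ∞ f.1 x :=
  f.2.contDiffAt (hW.mem_nhds hx)

theorem differentiableAt (hW : IsOpen W) (f : SmoothOn W) {x : E} (hx : x ∈ W) :
    DifferentiableAt ℝ f.1 x :=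
  (f.contDiffAt hW hx).differentiableAt (by simp)

theorem contDiffAt_fderiv (hW : IsOpen W) (f : SmoothOn W) {x : E} (hx : x ∈ W) :
    ContDiffAt ℝ ∞ (fderiv ℝ f.1) x :=
  (f.contDiffAt hW hx).fderiv_right le_rfl

theorem contDiffAt_fderiv_apply (hW : IsOpen W) (f : SmoothOn W) {x : E} (hx : x ∈ W) (w : E) :
    ContDiffAt ℝ ∞ (fun y => fderiv ℝ f.1 y w) x :=
  (f.contDiffAt_fderiv hW hx).clm_apply contDiffAt_const

theorem fderiv_fderiv_apply (hW : IsOpen W) (f : SmoothOn W) {x : E} (hx : x ∈ W) (u w : E) :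
    fderiv ℝ (fun y => fderiv ℝ f.1 y w) x u = fderiv ℝ (fderiv ℝ f.1) x u w := by
  have h := ((f.contDiffAt_fderiv hW hx).differentiableAt (by simp)).hasFDerivAt.clm_apply
    (hasFDerivAt_const w x)
  rw [h.fderiv]
  simp

theorem fderiv_fderiv_apply_comm (hW : IsOpen W) (f : SmoothOn W) {x : E} (hx : x ∈ W) (u w : E) :
    fderiv ℝ (fun y => fderiv ℝ f.1 y w) x u = fderiv ℝ (fun y => fderiv ℝ f.1 y u) x w := by
  rw [f.fderiv_fderiv_apply hW hx, f.fderiv_fderiv_apply hW hx]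
  exact (f.contDiffAt hW hx).isSymmSndFDerivAt
    (by simpa using ENat.LEInfty.out) u w

/-- Evaluation of derivatives is jointly continuous in the function and the point. -/
theorem continuousOn_iteratedFDeriv [FiniteDimensional ℝ E] (hW : IsOpen W) (k : ℕ) :
    ContinuousOn (fun p : SmoothOn W × E => iteratedFDeriv ℝ k p.1.1 p.2) (univ ×ˢ W) := by
  rintro ⟨f, x⟩ ⟨-, hx⟩
  obtain ⟨K, hK, hxK, hKW⟩ := exists_compact_subset hW hx
  have hloc : TendstoUniformlyOn (fun p : SmoothOn W × E => iteratedFDeriv ℝ k p.1.1)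
      (iteratedFDeriv ℝ k f.1) (𝓝[univ ×ˢ W] (f, x)) K :=
    tendsto_nhds_iff.1 ((continuous_fst.tendsto (f, x)).mono_left nhdsWithin_le_nhds) k K hK hKW
  have hc : ContinuousWithinAt (iteratedFDeriv ℝ k f.1) univ x :=
    ((f.contDiffAt hW hx).continuousAt_iteratedFDeriv
      (by exact_mod_cast le_top)).continuousWithinAt
  refine tendsto_comp_of_locally_uniform_limit_within
    (F := fun p : SmoothOn W × E => iteratedFDeriv ℝ k p.1.1) hc ?_ ?_
  · rw [nhdsWithin_univ]
    exact (continuous_snd.tendsto (f, x)).mono_left nhdsWithin_le_nhds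
  · intro u hu
    exact ⟨K, by rw [nhdsWithin_univ]; exact mem_interior_iff_mem_nhds.1 hxK, hloc u hu⟩

theorem continuousOn_fderiv_apply [FiniteDimensional ℝ E] (hW : IsOpen W) (w : E) :
    ContinuousOn (fun p : SmoothOn W × E => fderiv ℝ p.1.1 p.2 w) (univ ×ˢ W) := by
  have h := (ContinuousMultilinearMap.apply ℝ (fun _ : Fin 1 => E) ℝ
    (fun _ => w)).continuous.comp_continuousOn (continuousOn_iteratedFDeriv hW 1)
  refine h.congr fun p _ => ?_
  simp [iteratedFDeriv_one_apply]

theorem continuousOn_fderiv_fderiv_apply [FiniteDimensional ℝ E] (hW : IsOpen W) (w : E) :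
    ContinuousOn (fun p : SmoothOn W × E => fderiv ℝ (fun y => fderiv ℝ p.1.1 y w) p.2)
      (univ ×ˢ W) := by
  rw [continuousOn_clm_apply]
  intro u
  have h := (ContinuousMultilinearMap.apply ℝ (fun _ : Fin 2 => E) ℝ
    ![u, w]).continuous.comp_continuousOn (continuousOn_iteratedFDeriv hW 2)
  refine h.congr fun p hp => ?_
  simp [iteratedFDeriv_two_apply, p.1.fderiv_fderiv_apply hW hp.2]

/-- The function `f + t g`. -/
def addSMul (f : SmoothOn W) (t : ℝ) (g : SmoothOn W) : SmoothOn W :=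
  ⟨fun x => f.1 x + t * g.1 x, f.2.add (contDiffOn_const.mul g.2)⟩

theorem iteratedFDeriv_addSMul (hW : IsOpen W) (f : SmoothOn W) (t : ℝ) (g : SmoothOn W) (k : ℕ)
    {x : E} (hx : x ∈ W) :
    iteratedFDeriv ℝ k (f.addSMul t g).1 x =
      iteratedFDeriv ℝ k f.1 x + t • iteratedFDeriv ℝ k g.1 x := by
  have hk : (k : ℕ∞ω) ≤ ∞ := by exact_mod_cast le_top
  have hf := (f.contDiffAt hW hx).of_le hk
  have hg := (g.contDiffAt hW hx).of_le hk
  have h := iteratedFDeriv_add_apply (f := f.1) (g := t • g.1) hf (hg.const_smul t)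
  rw [iteratedFDeriv_const_smul_apply hg] at h
  exact h

theorem fderiv_addSMul (hW : IsOpen W) (f : SmoothOn W) (t : ℝ) (g : SmoothOn W)
    {x : E} (hx : x ∈ W) :
    fderiv ℝ (f.addSMul t g).1 x = fderiv ℝ f.1 x + t • fderiv ℝ g.1 x :=
  ((f.differentiableAt hW hx).hasFDerivAt.add
    ((g.differentiableAt hW hx).hasFDerivAt.const_mul t)).fderiv

theorem fderiv_fderiv_addSMul (hW : IsOpen W) (f : SmoothOn W) (t : ℝ) (g : SmoothOn W)
    {x : E} (hx : x ∈ W) (w : E) :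
    fderiv ℝ (fun y => fderiv ℝ (f.addSMul t g).1 y w) x =
      fderiv ℝ (fun y => fderiv ℝ f.1 y w) x + t • fderiv ℝ (fun y => fderiv ℝ g.1 y w) x := by
  have h : (fun y => fderiv ℝ (f.addSMul t g).1 y w) =ᶠ[𝓝 x]
      fun y => fderiv ℝ f.1 y w + t * fderiv ℝ g.1 y w := by
    filter_upwards [hW.mem_nhds hx] with y hy
    rw [fderiv_addSMul hW f t g hy]
    rfl
  rw [h.fderiv_eq]
  exact (((f.contDiffAt_fderiv_apply hW hx w).differentiableAt (by simp)).hasFDerivAt.add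
    (((g.contDiffAt_fderiv_apply hW hx w).differentiableAt (by simp)).hasFDerivAt.const_mul
      t)).fderiv

/-- All density arguments move a system along such lines and let the parameter tend to 0. The point
is that each derivative of `g` is bounded on each compact set. -/
theorem continuous_addSMul (hW : IsOpen W) (g : SmoothOn W) :
    Continuous fun p : SmoothOn W × ℝ => p.1.addSMul p.2 g := by
  rw [continuous_iff_continuousAt]
  rintro ⟨f, t⟩
  refine tendsto_nhds_iff.2 fun k K hK hKW => ?_
  have h1 : TendstoUniformlyOn (fun p : SmoothOn W × ℝ => iteratedFDeriv ℝ k p.1.1)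
      (iteratedFDeriv ℝ k f.1) (𝓝 (f, t)) K :=
    tendsto_nhds_iff.1 (continuous_fst.tendsto (f, t)) k K hK hKW
  have h2 : TendstoUniformlyOn (fun (p : SmoothOn W × ℝ) x => p.2 • iteratedFDeriv ℝ k g.1 x)
      (fun x => t • iteratedFDeriv ℝ k g.1 x) (𝓝 (f, t)) K := by
    have hc : ContinuousOn (iteratedFDeriv ℝ k g.1) K := fun x hx =>
      ((g.contDiffAt hW (hKW hx)).continuousAt_iteratedFDeriv
        (by exact_mod_cast le_top)).continuousWithinAt
    obtain ⟨C, hC⟩ := hK.exists_bound_of_continuousOn hc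
    rw [Metric.tendstoUniformlyOn_iff]
    intro ε hε
    have hlim : Tendsto (fun p : SmoothOn W × ℝ => |t - p.2| * (|C| + 1)) (𝓝 (f, t)) (𝓝 0) := by
      have : Continuous fun p : SmoothOn W × ℝ => |t - p.2| * (|C| + 1) := by fun_prop
      simpa using this.tendsto (f, t)
    filter_upwards [hlim.eventually (gt_mem_nhds hε)] with p hp x hx
    rw [dist_eq_norm, ← sub_smul, norm_smul]
    refine lt_of_le_of_lt ?_ hp
    rw [Real.norm_eq_abs]
    gcongr
    linarith [hC x hx, le_abs_self C]
  refine ((h1.add h2).congr (Eventually.of_forall fun p x hx => ?_)).congr_right fun x hx => ?_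
  · exact (iteratedFDeriv_addSMul hW p.1 p.2 g k (hKW hx)).symm
  · exact (iteratedFDeriv_addSMul hW f t g k (hKW hx)).symm

theorem addSMul_zero (f g : SmoothOn W) : f.addSMul 0 g = f :=
  Subtype.ext (funext fun x => by simp [addSMul])

/-- Functions that agree with `f` near larger and larger compact sets converge to `f`. -/
theorem mem_closure_of_forall_isCompact {f : SmoothOn W} {S : Set (SmoothOn W)}
    (h : ∀ K : Set E, IsCompact K → K ⊆ W → ∃ g ∈ S, ∀ x ∈ K, g.1 =ᶠ[𝓝 x] f.1) :
    f ∈ closure S := by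
  -- The chosen functions form a net indexed by the compact subsets of `W`, directed by inclusion.
  -- Agreement near `K`, not just on it, makes all derivatives agree on `K`.
  choose g hgS hg using fun K : {K : Set E // IsCompact K ∧ K ⊆ W} => h K.1 K.2.1 K.2.2
  have : Nonempty {K : Set E // IsCompact K ∧ K ⊆ W} := ⟨⟨∅, isCompact_empty, empty_subset W⟩⟩
  have : IsDirectedOrder {K : Set E // IsCompact K ∧ K ⊆ W} :=
    ⟨fun A B => ⟨⟨A.1 ∪ B.1, A.2.1.union B.2.1, union_subset A.2.2 B.2.2⟩,
      subset_union_left (s := A.1), subset_union_right (t := B.1)⟩⟩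
  refine mem_closure_of_tendsto (b := atTop) (f := g) ?_ (Eventually.of_forall hgS)
  refine tendsto_nhds_iff.2 fun k K hK hKW => ?_
  intro u hu
  filter_upwards [eventually_ge_atTop ⟨K, hK, hKW⟩] with L hL x hx
  rw [((hg L x (hL hx)).iteratedFDeriv ℝ k).eq_of_nhds]
  exact refl_mem_uniformity hu

end SmoothOn

end Resonance

namespace Resonance

/-! ### Circles of fixed points in terms of the gradient and the Hessian -/

/-- The gradient `(∂H/∂x, ∂H/∂v, ∂H/∂D)`. -/
def grad (H : Base → ℝ) (q : Base) : Base := (pdx H q, pdv H q, pdD H q)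

/-- The derivative of the gradient. -/
def gradDeriv (H : Base → ℝ) (q : Base) : Base →L[ℝ] Base :=
  (fderiv ℝ (pdx H) q).prod ((fderiv ℝ (pdv H) q).prod (fderiv ℝ (pdD H) q))

variable {U : Set Base}

theorem hasFDerivAt_grad (hU : IsOpen U) (f : SmoothOn U) {q : Base} (hq : q ∈ U) :
    HasFDerivAt (grad f.1) (gradDeriv f.1 q) q := by
  have h := fun w => ((f.contDiffAt_fderiv_apply hU hq w).differentiableAt (by simp)).hasFDerivAt
  exact (h _).prodMk ((h _).prodMk (h _))

theorem isCircleOfFixedPoints_lift_iff (hU : IsOpen U) (f : SmoothOn U) {q : Base} (hq : q ∈ U) :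
    IsCircleOfFixedPoints (lift f.1) q ↔ grad f.1 q = 0 := by
  have h : ∀ θ : ℝ, fderiv ℝ (lift f.1) (q, θ) =
      (fderiv ℝ f.1 q).comp (ContinuousLinearMap.fst ℝ Base ℝ) := fun θ =>
    ((f.differentiableAt hU hq).hasFDerivAt.comp (q, θ)
      (hasFDerivAt_fst (𝕜 := ℝ) (p := (q, θ)))).fderiv
  simp only [IsCircleOfFixedPoints, hamiltonianField, h, grad, pdx, pdv, pdD]
  have h0 : fderiv ℝ f.1 q ((0, 0, 0) : Base) = 0 := (fderiv ℝ f.1 q).map_zero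
  simp only [ContinuousLinearMap.comp_apply, ContinuousLinearMap.coe_fst', Prod.ext_iff,
    Prod.fst_zero, Prod.snd_zero, neg_eq_zero, h0, forall_const]
  tauto

/-- The three differentials are the rows of `gradDeriv`. If the determinant vanishes, a kernel
vector is killed by all rows; independent rows would span the dual space, which separates that
vector from 0. -/
theorem isTransverse_iff_det_ne_zero (H : Base → ℝ) (q : Base) :
    IsTransverse H q ↔ (gradDeriv H q).det ≠ 0 := by
  constructor
  · intro h hdet
    obtain ⟨w, hw, hw0⟩ : ∃ w : Base, gradDeriv H q w = 0 ∧ w ≠ 0 := by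
      have := LinearMap.bot_lt_ker_of_det_eq_zero
        (f := (gradDeriv H q : Base →ₗ[ℝ] Base)) hdet
      obtain ⟨w, hw, hw0⟩ := Submodule.exists_mem_ne_zero_of_ne_bot this.ne'
      exact ⟨w, hw, hw0⟩
    have hfin : Module.finrank ℝ (Base →L[ℝ] ℝ) = 3 := by
      rw [← (LinearMap.toContinuousLinearMap (𝕜 := ℝ) (E := Base) (F' := ℝ)).finrank_eq,
        Module.finrank_linearMap]
      simp
    have hspan := h.span_eq_top_of_card_eq_finrank (by simp [hfin])
    obtain ⟨g, hg⟩ := exists_dual_vector ℝ w (norm_ne_zero_iff.2 hw0)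
    have hmem : g ∈ Submodule.span ℝ
        (range ![fderiv ℝ (pdx H) q, fderiv ℝ (pdv H) q, fderiv ℝ (pdD H) q]) := by
      rw [hspan]; trivial
    simp only [gradDeriv, ContinuousLinearMap.prod_apply, Prod.ext_iff, Prod.fst_zero,
      Prod.snd_zero] at hw
    have hgw : g w = 0 := by
      refine Submodule.span_induction (p := fun g _ => g w = 0) ?_ rfl ?_ ?_ hmem
      · rintro _ ⟨i, rfl⟩
        fin_cases i
        exacts [hw.1, hw.2.1, hw.2.2]
      · intro a b _ _ ha hb
        simp [ha, hb]
      · intro c a _ ha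
        simp [ha]
    have := hg.2
    rw [hgw] at this
    exact hw0 (norm_eq_zero.1 (by simpa using this.symm))
  · intro hdet
    rw [IsTransverse, Fintype.linearIndependent_iff]
    intro c hc
    -- Evaluating the relation with coefficients `c` at the preimage of `c` itself gives a vanishing
    -- sum of squares.
    obtain ⟨w, hw⟩ :=
      ((gradDeriv H q).toContinuousLinearEquivOfDetNeZero hdet).surjective (c 0, c 1, c 2)
    rw [ContinuousLinearMap.toContinuousLinearEquivOfDetNeZero_apply] at hw
    simp only [gradDeriv, ContinuousLinearMap.prod_apply, Prod.mk.injEq] at hw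
    have h := DFunLike.congr_fun hc w
    simp [Fin.sum_univ_three, hw.1, hw.2.1, hw.2.2] at h
    have h0 : c 0 = 0 := by nlinarith [sq_nonneg (c 0), sq_nonneg (c 1), sq_nonneg (c 2)]
    have h1 : c 1 = 0 := by nlinarith [sq_nonneg (c 0), sq_nonneg (c 1), sq_nonneg (c 2)]
    have h2 : c 2 = 0 := by nlinarith [sq_nonneg (c 0), sq_nonneg (c 1), sq_nonneg (c 2)]
    intro i
    fin_cases i <;> assumption

/-- The determinant of the Hessian in the `(x, v)` plane. -/
def planarDet (H : Base → ℝ) (q : Base) : ℝ :=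
  pdx (pdx H) q * pdv (pdv H) q - pdv (pdx H) q ^ 2

theorem pdx_pdv_eq (hU : IsOpen U) (f : SmoothOn U) {q : Base} (hq : q ∈ U) :
    pdx (pdv f.1) q = pdv (pdx f.1) q :=
  f.fderiv_fderiv_apply_comm hU hq _ _

/-- Equality of mixed partials makes the trace zero, and the determinant of the Jacobian is that of
the planar Hessian. -/
theorem mem_spectrum_planarJacobian_iff (hU : IsOpen U) (f : SmoothOn U) {q : Base} (hq : q ∈ U)
    (μ : ℂ) :
    μ ∈ spectrum ℂ ((planarJacobian f.1 q).map (algebraMap ℝ ℂ)) ↔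
      μ ^ 2 + (planarDet f.1 q : ℂ) = 0 := by
  rw [spectrum.mem_iff, Matrix.isUnit_iff_isUnit_det, isUnit_iff_ne_zero, not_not]
  have h : (algebraMap ℂ (Matrix (Fin 2) (Fin 2) ℂ) μ -
      (planarJacobian f.1 q).map (algebraMap ℝ ℂ)).det = μ ^ 2 + (planarDet f.1 q : ℂ) := by
    rw [Matrix.det_fin_two]
    simp [planarJacobian, planarDet, pdx_pdv_eq hU f hq, Matrix.algebraMap_eq_diagonal]
    ring
  rw [h]

theorem sq_add_ofReal_eq_zero_iff (μ : ℂ) (d : ℝ) :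
    μ ^ 2 + (d : ℂ) = 0 ↔ μ.re ^ 2 - μ.im ^ 2 + d = 0 ∧ μ.re * μ.im = 0 := by
  rw [Complex.ext_iff]
  simp only [sq, Complex.add_re, Complex.mul_re, Complex.ofReal_re, Complex.zero_re,
    Complex.add_im, Complex.mul_im, Complex.ofReal_im, Complex.zero_im, add_zero]
  constructor <;> rintro ⟨h1, h2⟩ <;> exact ⟨h1, by linarith⟩

/-- For `d ≥ 0` the root `i√d` lies on the imaginary axis; this includes the degenerate case `d =
0`, which belongs to neither type. -/
theorem forall_sq_add_eq_zero_re_ne_zero_iff (d : ℝ) :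
    (∀ μ : ℂ, μ ^ 2 + (d : ℂ) = 0 → μ.re ≠ 0) ↔ d < 0 := by
  simp only [sq_add_ofReal_eq_zero_iff]
  constructor
  · intro h
    by_contra! hd
    exact h ⟨0, √d⟩ (by simp [Real.sq_sqrt hd]) rfl
  · rintro hd μ ⟨h1, -⟩ h0
    rw [h0] at h1
    nlinarith [sq_nonneg μ.im]

theorem forall_sq_add_eq_zero_re_eq_zero_iff (d : ℝ) :
    (∀ μ : ℂ, μ ^ 2 + (d : ℂ) = 0 → μ.re = 0 ∧ μ ≠ 0) ↔ 0 < d := by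
  simp only [sq_add_ofReal_eq_zero_iff]
  constructor
  · intro h
    by_contra! hd
    obtain ⟨h1, h2⟩ := h ⟨√(-d), 0⟩ (by simp [Real.sq_sqrt (neg_nonneg.2 hd)])
    exact h2 (Complex.ext h1 rfl)
  · rintro hd μ ⟨h1, h2⟩
    rcases mul_eq_zero.1 h2 with h0 | h0
    · refine ⟨h0, ?_⟩
      rintro rfl
      simp at h1
      exact hd.ne' h1
    · rw [h0] at h1
      nlinarith [sq_nonneg μ.re]

theorem isNormallyHyperbolicCircle_iff (hU : IsOpen U) (f : SmoothOn U) {q : Base} (hq : q ∈ U) :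
    IsNormallyHyperbolicCircle f.1 q ↔ grad f.1 q = 0 ∧ planarDet f.1 q < 0 := by
  simp only [IsNormallyHyperbolicCircle, isCircleOfFixedPoints_lift_iff hU f hq,
    mem_spectrum_planarJacobian_iff hU f hq, forall_sq_add_eq_zero_re_ne_zero_iff]

theorem isNormallyEllipticCircle_iff (hU : IsOpen U) (f : SmoothOn U) {q : Base} (hq : q ∈ U) :
    IsNormallyEllipticCircle f.1 q ↔ grad f.1 q = 0 ∧ 0 < planarDet f.1 q := by
  simp only [IsNormallyEllipticCircle, isCircleOfFixedPoints_lift_iff hU f hq,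
    mem_spectrum_planarJacobian_iff hU f hq, forall_sq_add_eq_zero_re_eq_zero_iff]

/-! ### The first-order effect of the perturbation -/

variable {ε₀ : ℝ}

theorem isOpen_perturbationDomain (hU : IsOpen U) :
    IsOpen (U ×ˢ (univ : Set ℝ) ×ˢ Ioo (-ε₀) ε₀) :=
  hU.prod (isOpen_univ.prod isOpen_Ioo)

theorem mem_perturbationDomain (hε₀ : 0 < ε₀) {q : Base} (hq : q ∈ U) (θ : ℝ) :
    (q, θ, (0 : ℝ)) ∈ U ×ˢ (univ : Set ℝ) ×ˢ Ioo (-ε₀) ε₀ :=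
  ⟨hq, trivial, by simpa using hε₀, hε₀⟩

namespace NearIntegrable

/-- Since `H₀` does not depend on θ, the D-component of the field is `ε * g ε`. Its difference
quotient at 0 is `g ε`, so continuity of `g` suffices. -/
theorem deriv_hamiltonianField (hU : IsOpen U) (hε₀ : 0 < ε₀) (N : NearIntegrable U ε₀)
    {q : Base} (hq : q ∈ U) (θ : ℝ) :
    deriv (fun ε : ℝ => (hamiltonianField (N.hamiltonian ε) (q, θ)).1.2.2) 0 =
      -fderiv ℝ N.2.1.1 (q, θ, 0) (0, 1, 0) := by
  set g : ℝ → ℝ := fun ε => -fderiv ℝ N.2.1.1 (q, θ, ε) (0, 1, 0) with hg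
  have hW := isOpen_perturbationDomain (ε₀ := ε₀) hU
  have heq : (fun ε : ℝ => (hamiltonianField (N.hamiltonian ε) (q, θ)).1.2.2) =ᶠ[𝓝 0]
      fun ε => ε * g ε := by
    filter_upwards [Ioo_mem_nhds (neg_lt_zero.2 hε₀) hε₀] with ε hε
    have hmem : (q, θ, ε) ∈ U ×ˢ (univ : Set ℝ) ×ˢ Ioo (-ε₀) ε₀ := ⟨hq, trivial, hε⟩
    have h0 : HasFDerivAt (fun z : Phase => N.1.1 z.1)
        ((fderiv ℝ N.1.1 q).comp (ContinuousLinearMap.fst ℝ Base ℝ)) (q, θ) :=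
      (N.1.differentiableAt hU hq).hasFDerivAt.comp (q, θ) hasFDerivAt_fst
    have hj : HasFDerivAt (fun z : Phase => (z.1, z.2, ε))
        ((ContinuousLinearMap.fst ℝ Base ℝ).prod ((ContinuousLinearMap.snd ℝ Base ℝ).prod 0))
        (q, θ) :=
      hasFDerivAt_fst.prodMk (hasFDerivAt_snd.prodMk (hasFDerivAt_const ε _))
    have h1 : HasFDerivAt (fun z : Phase => N.2.1.1 (z.1, z.2, ε)) _ (q, θ) :=
      (N.2.1.differentiableAt hW hmem).hasFDerivAt.comp (q, θ) hj
    have h := (h0.add (h1.const_mul ε)).fderiv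
    change -fderiv ℝ (fun z : Phase => N.1.1 z.1 + ε * N.2.1.1 (z.1, z.2, ε)) (q, θ)
      ((0, 0, 0), 1) = _
    have hz : fderiv ℝ N.1.1 q ((0, 0, 0) : Base) = 0 := (fderiv ℝ N.1.1 q).map_zero
    have hadd : (fun z : Phase => N.1.1 z.1 + ε * N.2.1.1 (z.1, z.2, ε)) =
      (fun z : Phase => N.1.1 z.1) + fun z : Phase => ε * N.2.1.1 (z.1, z.2, ε) := rfl
    rw [hadd, h]
    simp only [_root_.add_apply, _root_.smul_apply,
      ContinuousLinearMap.comp_apply, ContinuousLinearMap.prod_apply,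
      ContinuousLinearMap.coe_fst', ContinuousLinearMap.coe_snd', _root_.zero_apply,
      hz, hg, smul_eq_mul, zero_add, mul_neg]
    rfl
  rw [heq.deriv_eq]
  have hcont : ContinuousAt g 0 := by
    have h1 := (N.2.1.contDiffAt_fderiv_apply hW (mem_perturbationDomain hε₀ hq θ)
      (0, 1, 0)).continuousAt
    have h2 : ContinuousAt (fun ε : ℝ => (q, θ, ε)) 0 := by fun_prop
    exact (ContinuousAt.comp (f := fun ε : ℝ => (q, θ, ε)) h1 h2).neg
  refine HasDerivAt.deriv (f' := g 0) ?_
  rw [hasDerivAt_iff_tendsto_slope]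
  refine (hcont.tendsto.mono_left nhdsWithin_le_nhds).congr' ?_
  filter_upwards [self_mem_nhdsWithin] with ε hε
  have hε' : ε ≠ 0 := hε
  simp only [slope, sub_zero, zero_mul, vsub_eq_sub, smul_eq_mul]
  field_simp

theorem perturbsCircle_iff (hU : IsOpen U) (hε₀ : 0 < ε₀) (N : NearIntegrable U ε₀)
    {q : Base} (hq : q ∈ U) :
    N.PerturbsCircle q ↔ ∃ θ : ℝ, fderiv ℝ N.2.1.1 (q, θ, 0) (0, 1, 0) ≠ 0 := by
  simp only [PerturbsCircle, deriv_hamiltonianField hU hε₀ N hq, ne_eq, neg_eq_zero]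

end NearIntegrable

end Resonance

namespace Resonance

/-! ### Robustness of the conditions, and persistence of transverse circles -/

variable {U : Set Base} {ε₀ : ℝ}

theorem continuousOn_grad (hU : IsOpen U) :
    ContinuousOn (fun p : SmoothOn U × Base => grad p.1.1 p.2) (univ ×ˢ U) := by
  have h := fun w => SmoothOn.continuousOn_fderiv_apply hU w
  exact (h _).prodMk ((h _).prodMk (h _))

theorem continuousOn_gradDeriv (hU : IsOpen U) :
    ContinuousOn (fun p : SmoothOn U × Base => gradDeriv p.1.1 p.2) (univ ×ˢ U) := by
  have h := fun w => SmoothOn.continuousOn_fderiv_fderiv_apply hU w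
  rw [continuousOn_clm_apply]
  intro u
  have h' := fun w => continuousOn_clm_apply.1 (h w) u
  exact (h' _).prodMk ((h' _).prodMk (h' _))

theorem continuousOn_planarDet (hU : IsOpen U) :
    ContinuousOn (fun p : SmoothOn U × Base => planarDet p.1.1 p.2) (univ ×ˢ U) := by
  have h := fun w u =>
    continuousOn_clm_apply.1 (SmoothOn.continuousOn_fderiv_fderiv_apply hU w) u
  exact ((h _ _).mul (h _ _)).sub ((h _ _).pow 2)

theorem univ_prod_mem_nhds {X : Type*} [TopologicalSpace X] (hU : IsOpen U) (f : X) {q : Base}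
    (hq : q ∈ U) : univ ×ˢ U ∈ 𝓝 (f, q) :=
  (isOpen_univ.prod hU).mem_nhds ⟨trivial, hq⟩

theorem eventually_isTransverse (hU : IsOpen U) {f : SmoothOn U} {q : Base} (hq : q ∈ U)
    (h : IsTransverse f.1 q) : ∀ᶠ p in 𝓝 (f, q), IsTransverse p.1.1 p.2 := by
  simp only [isTransverse_iff_det_ne_zero] at h ⊢
  have hc := (continuousOn_gradDeriv hU).continuousAt (univ_prod_mem_nhds hU f hq)
  exact (ContinuousLinearMap.continuous_det.continuousAt.comp hc).eventually_ne h

theorem eventually_exists_fderiv_ne_zero (hU : IsOpen U) (hε₀ : 0 < ε₀) {N : NearIntegrable U ε₀}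
    {q : Base} (hq : q ∈ U) (h : ∃ θ : ℝ, fderiv ℝ N.2.1.1 (q, θ, 0) (0, 1, 0) ≠ 0) :
    ∀ᶠ p : NearIntegrable U ε₀ × Base in 𝓝 (N, q),
      ∃ θ : ℝ, fderiv ℝ p.1.2.1.1 (p.2, θ, 0) (0, 1, 0) ≠ 0 := by
  obtain ⟨θ, hθ⟩ := h
  have hW := isOpen_perturbationDomain (ε₀ := ε₀) hU
  have hc := (SmoothOn.continuousOn_fderiv_apply hW (0, 1, 0)).continuousAt (x := (N.2.1, q, θ, 0))
    ((isOpen_univ.prod hW).mem_nhds ⟨trivial, mem_perturbationDomain hε₀ hq θ⟩)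
  have hj : Continuous fun p : NearIntegrable U ε₀ × Base => (p.1.2.1, p.2, θ, (0 : ℝ)) := by
    refine Continuous.prodMk ?_ (by fun_prop)
    exact continuous_subtype_val.comp (continuous_snd.comp continuous_fst)
  filter_upwards [(ContinuousAt.comp (f := fun p : NearIntegrable U ε₀ × Base =>
    (p.1.2.1, p.2, θ, (0 : ℝ))) (x := (N, q)) hc hj.continuousAt).eventually_ne hθ] with p hp
  exact ⟨θ, hp⟩

theorem tendsto_unperturbed (N : NearIntegrable U ε₀) (q : Base) :
    Tendsto (fun p : NearIntegrable U ε₀ × Base => (p.1.1, p.2)) (𝓝 (N, q)) (𝓝 (N.1, q)) :=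
  ((continuous_fst.comp continuous_fst).prodMk continuous_snd).tendsto (N, q)

/-- A nondegenerate critical point persists, and remains locally unique, under perturbations that
are small in the weak smooth topology. -/
theorem eventually_existsUnique_grad_eq_zero (hU : IsOpen U) (f₀ : SmoothOn U) {q₀ : Base}
    (hq₀ : q₀ ∈ U) (h0 : grad f₀.1 q₀ = 0) (ht : IsTransverse f₀.1 q₀) {W : Set Base}
    (hW : W ∈ 𝓝 q₀) :
    ∃ V ∈ 𝓝 q₀, V ⊆ W ∧ ∀ᶠ f in 𝓝 f₀, ∃ q ∈ V, grad f.1 q = 0 ∧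
      ∀ q' ∈ V, grad f.1 q' = 0 → q' = q := by
  rw [isTransverse_iff_det_ne_zero] at ht
  set A := (gradDeriv f₀.1 q₀).toContinuousLinearEquivOfDetNeZero ht with hA
  have hAc : (A : Base →L[ℝ] Base) = gradDeriv f₀.1 q₀ :=
    (gradDeriv f₀.1 q₀).coe_toContinuousLinearEquivOfDetNeZero ht
  -- `m` is the least expansion rate of the linearization `A`. A derivative within `c = m / 2` of
  -- `A` keeps the map injective and still expanding at rate at least `m - c`.
  set m : ℝ := ‖(A.symm : Base →L[ℝ] Base)‖⁻¹ with hm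
  have hm0 : 0 < m := inv_pos.2 A.norm_symm_pos
  set c : NNReal := ⟨m / 2, by positivity⟩ with hc
  have hcm : (c : ℝ) = m / 2 := rfl
  have hcont := (continuousOn_gradDeriv hU).continuousAt (univ_prod_mem_nhds hU f₀ hq₀)
  have hev : ∀ᶠ p : SmoothOn U × Base in 𝓝 (f₀, q₀), ‖gradDeriv p.1.1 p.2 - A‖ < c := by
    have := hcont.eventually (Metric.ball_mem_nhds _ (show (0 : ℝ) < c by rw [hcm]; positivity))
    filter_upwards [this] with p hp
    rw [hAc, ← dist_eq_norm]
    exact hp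
  obtain ⟨P, hP, Q, hQ, hPQ⟩ := (eventually_prod_iff.1 (nhds_prod_eq (x := f₀) (y := q₀) ▸ hev))
  obtain ⟨r, hr, hrs⟩ := Metric.nhds_basis_closedBall.mem_iff.1
    (inter_mem (inter_mem hW (hU.mem_nhds hq₀)) hQ)
  refine ⟨Metric.closedBall q₀ r, Metric.closedBall_mem_nhds _ hr,
    fun x hx => (hrs hx).1.1, ?_⟩
  -- The image of the ball of radius `r` contains the ball of radius `(m - c) * r = m / 2 * r` about
  -- `grad f.1 q₀`; this bound puts 0 in it.
  have hsmall : ∀ᶠ f in 𝓝 f₀, ‖grad f.1 q₀‖ < m / 2 * r := by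
    have hg := (continuousOn_grad hU).continuousAt (univ_prod_mem_nhds hU f₀ hq₀)
    have hg' : ContinuousAt (fun f : SmoothOn U => grad f.1 q₀) f₀ :=
      ContinuousAt.comp (f := fun f : SmoothOn U => (f, q₀)) hg (by fun_prop)
    refine hg'.norm.eventually_lt_const ?_
    change ‖grad f₀.1 q₀‖ < _
    rw [h0, norm_zero]
    positivity
  filter_upwards [hP, hsmall] with f hf hfs
  have happ : ApproximatesLinearOn (grad f.1) (A : Base →L[ℝ] Base) (Metric.closedBall q₀ r) c := by
    intro x hx y hy
    exact (convex_closedBall q₀ r).norm_image_sub_le_of_norm_hasFDerivWithin_le'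
      (fun z hz => (hasFDerivAt_grad hU f (hrs hz).1.2).hasFDerivWithinAt)
      (fun z hz => (hPQ hf (hrs hz).2).le) hy hx
  have hsurj := happ.surjOn_closedBall_of_nonlinearRightInverse A.toNonlinearRightInverse hr.le
    (subset_refl _)
  have hinj := happ.injOn (Or.inr (by
    rw [← NNReal.coe_lt_coe]
    change m / 2 < m
    linarith))
  obtain ⟨q, hq, hq0⟩ := hsurj (show (0 : Base) ∈ _ by
    rw [Metric.mem_closedBall, dist_zero_left]
    change ‖grad f.1 q₀‖ ≤ (m - m / 2) * r
    linarith)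
  exact ⟨q, hq, hq0, fun q' hq' h' => hinj hq' hq (h'.trans hq0.symm)⟩

/-- The resonances of one type: `σ` is the sign of the planar Hessian determinant. -/
def IsResonanceOfSign (σ : ℝ) (N : NearIntegrable U ε₀) (q : Base) : Prop :=
  q ∈ U ∧ grad N.1.1 q = 0 ∧ 0 < σ * planarDet N.1.1 q ∧
    ∃ θ : ℝ, fderiv ℝ N.2.1.1 (q, θ, 0) (0, 1, 0) ≠ 0

theorem isHyperbolicResonance_iff (hU : IsOpen U) (hε₀ : 0 < ε₀) (N : NearIntegrable U ε₀)
    (q : Base) : N.IsHyperbolicResonance q ↔ IsResonanceOfSign (-1) N q := by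
  refine and_congr_right fun hq => ?_
  rw [NearIntegrable.unperturbed, isNormallyHyperbolicCircle_iff hU N.1 hq,
    N.perturbsCircle_iff hU hε₀ hq, and_assoc]
  simp

theorem isEllipticResonance_iff (hU : IsOpen U) (hε₀ : 0 < ε₀) (N : NearIntegrable U ε₀)
    (q : Base) : N.IsEllipticResonance q ↔ IsResonanceOfSign 1 N q := by
  refine and_congr_right fun hq => ?_
  rw [NearIntegrable.unperturbed, isNormallyEllipticCircle_iff hU N.1 hq,
    N.perturbsCircle_iff hU hε₀ hq, and_assoc]
  simp

/-- Transverse resonances persist under small perturbations. -/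
theorem IsResonanceOfSign.eventually (hU : IsOpen U) (hε₀ : 0 < ε₀) {σ : ℝ}
    {N : NearIntegrable U ε₀} {q : Base} (h : IsResonanceOfSign σ N q)
    (ht : IsTransverse N.1.1 q) {W : Set Base} (hW : W ∈ 𝓝 q) :
    ∃ V ∈ 𝓝 q, V ⊆ W ∧ ∀ᶠ N' : NearIntegrable U ε₀ in 𝓝 N,
      ∃ q' ∈ V, IsResonanceOfSign σ N' q' ∧ IsTransverse N'.1.1 q' ∧
        ∀ q'' ∈ V, IsCircleOfFixedPoints (lift N'.1.1) q'' → q'' = q' := by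
  obtain ⟨hq, hg, hd, hθ⟩ := h
  have hd' : ∀ᶠ p : SmoothOn U × Base in 𝓝 (N.1, q), 0 < σ * planarDet p.1.1 p.2 :=
    (((continuousOn_planarDet hU).continuousAt
      (univ_prod_mem_nhds hU N.1 hq)).const_mul σ).eventually_const_lt hd
  have hev := ((tendsto_unperturbed N q).eventually
    (hd'.and (eventually_isTransverse hU hq ht))).and
    (eventually_exists_fderiv_ne_zero hU hε₀ hq hθ)
  obtain ⟨P, hP, Q, hQ, hPQ⟩ := eventually_prod_iff.1 (nhds_prod_eq (x := N) (y := q) ▸ hev)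
  -- Shrinking `V` into `Q` forces the open conditions to hold at the new zero, wherever in `V` it
  -- lies.
  obtain ⟨V, hV, hVW, hex⟩ := eventually_existsUnique_grad_eq_zero hU N.1 hq hg ht
    (inter_mem (inter_mem hW (hU.mem_nhds hq)) hQ)
  refine ⟨V, hV, fun x hx => (hVW hx).1.1, ?_⟩
  filter_upwards [hP, (continuous_fst.tendsto N).eventually hex] with N' hN' hex'
  obtain ⟨q', hq', hg', huniq⟩ := hex'
  obtain ⟨⟨hd', ht'⟩, hθ'⟩ := hPQ hN' (hVW hq').2
  refine ⟨q', hq', ⟨(hVW hq').1.2, hg', hd', hθ'⟩, ht', fun q'' hq'' h'' => huniq q'' hq'' ?_⟩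
  exact (isCircleOfFixedPoints_lift_iff hU N'.1 (hVW hq'').1.2).1 h''

theorem onlySimpleResonances_iff (hU : IsOpen U) (hε₀ : 0 < ε₀) {K : Set Base} (hK : K ⊆ U)
    (N : NearIntegrable U ε₀) :
    OnlySimpleResonances K N ↔ ∀ q ∈ K, grad N.1.1 q = 0 → (planarDet N.1.1 q ≠ 0 ∧
      IsTransverse N.1.1 q) ∧ ∃ θ : ℝ, fderiv ℝ N.2.1.1 (q, θ, 0) (0, 1, 0) ≠ 0 := by
  refine forall₂_congr fun q hq => ?_
  rw [NearIntegrable.unperturbed, isCircleOfFixedPoints_lift_iff hU N.1 (hK hq),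
    isHyperbolicResonance_iff hU hε₀, isEllipticResonance_iff hU hε₀]
  refine forall_congr' fun hg => ?_
  have h1 : 0 < (-1) * planarDet N.1.1 q ↔ planarDet N.1.1 q < 0 := by simp
  have h2 : 0 < 1 * planarDet N.1.1 q ↔ 0 < planarDet N.1.1 q := by simp
  simp only [IsResonanceOfSign, h1, h2, hK hq, hg, true_and]
  rw [← or_and_right, ← ne_iff_lt_or_gt, and_right_comm]

theorem isOpen_onlySimpleResonances (hU : IsOpen U) (hε₀ : 0 < ε₀) {K : Set Base}
    (hK : IsCompact K) (hKU : K ⊆ U) :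
    IsOpen {N : NearIntegrable U ε₀ | OnlySimpleResonances K N} := by
  simp only [onlySimpleResonances_iff hU hε₀ hKU]
  rw [isOpen_iff_eventually]
  intro N hN
  refine hK.eventually_forall_of_forall_eventually fun q hq => ?_
  have hqU := univ_prod_mem_nhds hU N.1 (hKU hq)
  -- At a zero the required conditions hold on a neighbourhood; away from the zeros the gradient
  -- stays non-zero, so the implication is vacuous nearby.
  by_cases hg : grad N.1.1 q = 0
  · obtain ⟨⟨hd, ht⟩, hθ⟩ := hN q hq hg
    have hd' : ∀ᶠ p : SmoothOn U × Base in 𝓝 (N.1, q), planarDet p.1.1 p.2 ≠ 0 :=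
      ((continuousOn_planarDet hU).continuousAt hqU).eventually_ne hd
    filter_upwards [(tendsto_unperturbed N q).eventually
      (hd'.and (eventually_isTransverse hU (hKU hq) ht)),
      eventually_exists_fderiv_ne_zero hU hε₀ (hKU hq) hθ] with p h1 h2 _
    exact ⟨h1, h2⟩
  · have hg' : ∀ᶠ p : SmoothOn U × Base in 𝓝 (N.1, q), grad p.1.1 p.2 ≠ 0 :=
      ((continuousOn_grad hU).continuousAt hqU).eventually_ne hg
    filter_upwards [(tendsto_unperturbed N q).eventually hg'] with p h1 h2
    exact absurd h2 h1

end Resonance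

namespace Resonance

/-! ### Density of the nondegeneracy conditions -/

open MeasureTheory

variable {U : Set Base} {ε₀ : ℝ}

/-- The quadratic form `(a (x - x₀)² + b (v - v₀)² + c (D - D₀)²) / 2`. -/
def quadratic (a b c : ℝ) (q₀ : Base) : SmoothOn U :=
  ⟨fun q => (a * (q.1 - q₀.1) ^ 2 + b * (q.2.1 - q₀.2.1) ^ 2 + c * (q.2.2 - q₀.2.2) ^ 2) / 2,
    ContDiff.contDiffOn (by fun_prop)⟩

theorem fderiv_quadratic (a b c : ℝ) (q₀ q w : Base) :
    fderiv ℝ (quadratic (U := U) a b c q₀).1 q w =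
      a * (q.1 - q₀.1) * w.1 + b * (q.2.1 - q₀.2.1) * w.2.1 + c * (q.2.2 - q₀.2.2) * w.2.2 := by
  have h1 : HasFDerivAt (fun q : Base => q.1 - q₀.1) _ q :=
    (hasFDerivAt_fst (𝕜 := ℝ) (p := q)).sub_const _
  have h2 : HasFDerivAt (fun q : Base => q.2.1 - q₀.2.1) _ q :=
    (hasFDerivAt_fst.comp q (hasFDerivAt_snd (𝕜 := ℝ) (p := q))).sub_const _
  have h3 : HasFDerivAt (fun q : Base => q.2.2 - q₀.2.2) _ q :=
    (hasFDerivAt_snd.comp q (hasFDerivAt_snd (𝕜 := ℝ) (p := q))).sub_const _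
  have h := (((((h1.pow 2).const_mul a).add ((h2.pow 2).const_mul b)).add
    ((h3.pow 2).const_mul c)).mul_const (2⁻¹ : ℝ)).fderiv
  have he : (quadratic (U := U) a b c q₀).1 = fun q : Base =>
      (a * (q.1 - q₀.1) ^ 2 + b * (q.2.1 - q₀.2.1) ^ 2 + c * (q.2.2 - q₀.2.2) ^ 2) * 2⁻¹ := rfl
  rw [he]
  refine (DFunLike.congr_fun h w).trans ?_
  simp
  ring

theorem fderiv_fderiv_quadratic (a b c : ℝ) (q₀ q u w : Base) :
    fderiv ℝ (fun y => fderiv ℝ (quadratic (U := U) a b c q₀).1 y w) q u =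
      a * u.1 * w.1 + b * u.2.1 * w.2.1 + c * u.2.2 * w.2.2 := by
  simp only [fderiv_quadratic]
  have h1 : HasFDerivAt (fun q : Base => q.1 - q₀.1) _ q :=
    (hasFDerivAt_fst (𝕜 := ℝ) (p := q)).sub_const _
  have h2 : HasFDerivAt (fun q : Base => q.2.1 - q₀.2.1) _ q :=
    (hasFDerivAt_fst.comp q (hasFDerivAt_snd (𝕜 := ℝ) (p := q))).sub_const _
  have h3 : HasFDerivAt (fun q : Base => q.2.2 - q₀.2.2) _ q :=
    (hasFDerivAt_snd.comp q (hasFDerivAt_snd (𝕜 := ℝ) (p := q))).sub_const _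
  have h := ((((h1.const_mul a).mul_const w.1).add ((h2.const_mul b).mul_const w.2.1)).add
    ((h3.const_mul c).mul_const w.2.2)).fderiv
  refine (DFunLike.congr_fun h u).trans ?_
  simp
  ring

/-- A continuous linear form as a smooth function. -/
def SmoothOn.ofCLM (L : Base →L[ℝ] ℝ) : SmoothOn U := ⟨L, L.contDiff.contDiffOn⟩

theorem SmoothOn.fderiv_ofCLM (L : Base →L[ℝ] ℝ) (q : Base) :
    fderiv ℝ (SmoothOn.ofCLM (U := U) L).1 q = L := L.fderiv

theorem SmoothOn.fderiv_fderiv_ofCLM (L : Base →L[ℝ] ℝ) (q w : Base) :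
    fderiv ℝ (fun y => fderiv ℝ (SmoothOn.ofCLM (U := U) L).1 y w) q = 0 := by
  simp only [SmoothOn.fderiv_ofCLM, fderiv_fun_const, Pi.zero_apply]

/-- The function `H(x, v, D) + a x + b v + c D`, where `p = (a, b, c)`. -/
def addLinear (f : SmoothOn U) (p : Base) : SmoothOn U :=
  ((f.addSMul p.1 (.ofCLM (.fst ℝ ℝ (ℝ × ℝ)))).addSMul p.2.1
    (.ofCLM ((ContinuousLinearMap.fst ℝ ℝ ℝ).comp (.snd ℝ ℝ (ℝ × ℝ))))).addSMul p.2.2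
    (.ofCLM ((ContinuousLinearMap.snd ℝ ℝ ℝ).comp (.snd ℝ ℝ (ℝ × ℝ))))

theorem addLinear_zero (f : SmoothOn U) : addLinear f 0 = f := by
  simp [addLinear, SmoothOn.addSMul_zero]

theorem continuous_addLinear (hU : IsOpen U) (f : SmoothOn U) : Continuous (addLinear f) := by
  have h := fun g : SmoothOn U => SmoothOn.continuous_addSMul hU g
  exact (h _).comp (((h _).comp (((h _).comp
    (continuous_const.prodMk continuous_fst)).prodMk (by fun_prop))).prodMk (by fun_prop))

theorem grad_addLinear (hU : IsOpen U) (f : SmoothOn U) (p : Base) {q : Base} (hq : q ∈ U) :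
    grad (addLinear f p).1 q = grad f.1 q + p := by
  simp [grad, pdx, pdv, pdD, addLinear, SmoothOn.fderiv_addSMul hU _ _ _ hq,
    SmoothOn.fderiv_ofCLM, Prod.ext_iff]

theorem fderiv_fderiv_addLinear (hU : IsOpen U) (f : SmoothOn U) (p : Base) {q : Base}
    (hq : q ∈ U) (w : Base) :
    fderiv ℝ (fun y => fderiv ℝ (addLinear f p).1 y w) q =
      fderiv ℝ (fun y => fderiv ℝ f.1 y w) q := by
  simp only [addLinear, SmoothOn.fderiv_fderiv_addSMul hU _ _ _ hq,
    SmoothOn.fderiv_fderiv_ofCLM, smul_zero, add_zero]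

theorem isTransverse_addLinear_iff (hU : IsOpen U) (f : SmoothOn U) (p : Base) {q : Base}
    (hq : q ∈ U) : IsTransverse (addLinear f p).1 q ↔ IsTransverse f.1 q := by
  have h := fderiv_fderiv_addLinear hU f p hq
  have hx : fderiv ℝ (pdx (addLinear f p).1) q = fderiv ℝ (pdx f.1) q := h _
  have hv : fderiv ℝ (pdv (addLinear f p).1) q = fderiv ℝ (pdv f.1) q := h _
  have hD : fderiv ℝ (pdD (addLinear f p).1) q = fderiv ℝ (pdD f.1) q := h _
  rw [IsTransverse, hx, hv, hD, IsTransverse]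

theorem planarDet_addLinear (hU : IsOpen U) (f : SmoothOn U) (p : Base) {q : Base}
    (hq : q ∈ U) : planarDet (addLinear f p).1 q = planarDet f.1 q := by
  have h := fun u w => DFunLike.congr_fun (fderiv_fderiv_addLinear hU f p hq w) u
  have hxx : pdx (pdx (addLinear f p).1) q = pdx (pdx f.1) q := h _ _
  have hvv : pdv (pdv (addLinear f p).1) q = pdv (pdv f.1) q := h _ _
  have hvx : pdv (pdx (addLinear f p).1) q = pdv (pdx f.1) q := h _ _
  rw [planarDet, hxx, hvv, hvx, planarDet]

/-- For fixed `q` this is a monic quadratic polynomial in `s`, so only finitely many `s` make it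
vanish. -/
theorem planarDet_addSMul_quadratic (hU : IsOpen U) (f : SmoothOn U) (s : ℝ) {q : Base}
    (hq : q ∈ U) : planarDet (f.addSMul s (quadratic 1 1 0 0)).1 q =
      (pdx (pdx f.1) q + s) * (pdv (pdv f.1) q + s) - pdv (pdx f.1) q ^ 2 := by
  have h : ∀ u w : Base, fderiv ℝ (fun y => fderiv ℝ (f.addSMul s (quadratic 1 1 0 0)).1 y w) q u =
      fderiv ℝ (fun y => fderiv ℝ f.1 y w) q u + s * (u.1 * w.1 + u.2.1 * w.2.1) := by
    intro u w
    rw [SmoothOn.fderiv_fderiv_addSMul hU _ _ _ hq]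
    simp [fderiv_fderiv_quadratic]
  have hxx : pdx (pdx (f.addSMul s (quadratic 1 1 0 0)).1) q = pdx (pdx f.1) q + s := by
    refine (h _ _).trans ?_
    simp only [mul_one, mul_zero, add_zero]
    rfl
  have hvv : pdv (pdv (f.addSMul s (quadratic 1 1 0 0)).1) q = pdv (pdv f.1) q + s := by
    refine (h _ _).trans ?_
    simp only [mul_one, mul_zero, zero_add]
    rfl
  have hvx : pdv (pdx (f.addSMul s (quadratic 1 1 0 0)).1) q = pdv (pdx f.1) q := by
    refine (h _ _).trans ?_
    simp only [mul_zero, zero_mul, add_zero]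
    rfl
  rw [planarDet, hxx, hvv, hvx]

theorem finite_setOf_shifted_mul_eq (a b d : ℝ) : {s : ℝ | (a + s) * (b + s) - d = 0}.Finite := by
  by_cases h : ∃ s₁ : ℝ, (a + s₁) * (b + s₁) - d = 0
  · obtain ⟨s₁, h₁⟩ := h
    -- The two roots sum to `-(a + b)`.
    refine (Set.toFinite {s₁, -(a + b) - s₁}).subset fun s hs => ?_
    have hs' : (a + s) * (b + s) - d = 0 := hs
    have : (s - s₁) * (s - (-(a + b) - s₁)) = 0 := by linear_combination hs' - h₁
    rcases mul_eq_zero.1 this with h | h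
    · exact Or.inl (sub_eq_zero.1 h)
    · exact Or.inr (sub_eq_zero.1 h)
  · convert Set.finite_empty
    exact eq_empty_of_forall_notMem fun s hs => h ⟨s, hs⟩

theorem isAddHaarMeasure_volume_base : (volume : Measure Base).IsAddHaarMeasure :=
  Measure.prod.instIsAddHaarMeasure (volume : Measure ℝ) (volume : Measure (ℝ × ℝ))

theorem continuousOn_planarDet_addSMul (hU : IsOpen U) (f g : SmoothOn U) :
    ContinuousOn (fun z : ℝ × Base => planarDet (f.addSMul z.1 g).1 z.2) (univ ×ˢ U) := by
  have hi : Continuous fun z : ℝ × Base => (f, z.1) := by fun_prop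
  have hk : Continuous fun z : ℝ × Base => f.addSMul z.1 g :=
    (SmoothOn.continuous_addSMul hU g).comp hi
  have hj : Continuous fun z : ℝ × Base => (f.addSMul z.1 g, z.2) := hk.prodMk continuous_snd
  exact ContinuousOn.comp (g := fun p : SmoothOn U × Base => planarDet p.1.1 p.2)
    (f := fun z : ℝ × Base => (f.addSMul z.1 g, z.2)) (continuousOn_planarDet hU)
    hj.continuousOn fun z hz => ⟨trivial, hz.2⟩

/-- Fubini in both directions: for each `q` the bad `s` are finite in number, so the bad pairs are
null, so for almost every `s` the bad `q` are null. -/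
theorem ae_volume_planarDet_eq_zero (hU : IsOpen U) (f : SmoothOn U) :
    ∀ᵐ s : ℝ, volume {q : Base | q ∈ U ∧
      planarDet (f.addSMul s (quadratic 1 1 0 0)).1 q = 0} = 0 := by
  let Φ : ℝ × Base → ℝ := fun z => planarDet (f.addSMul z.1 (quadratic 1 1 0 0)).1 z.2
  have hopen : IsOpen ((univ : Set ℝ) ×ˢ U) := isOpen_univ.prod hU
  have hc : ContinuousOn Φ (univ ×ˢ U) := continuousOn_planarDet_addSMul hU f _
  have hmeas : MeasurableSet {z : ℝ × Base | z.2 ∈ U ∧ Φ z = 0} := by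
    have : {z : ℝ × Base | z.2 ∈ U ∧ Φ z = 0} =
        (univ ×ˢ U) \ ((univ ×ˢ U) ∩ Φ ⁻¹' {0}ᶜ) := by
      ext z
      simp
    rw [this]
    exact hopen.measurableSet.diff
      (hc.isOpen_inter_preimage hopen isOpen_compl_singleton).measurableSet
  have hnull : (volume : Measure ℝ).prod (volume : Measure Base)
      {z : ℝ × Base | z.2 ∈ U ∧ Φ z = 0} = 0 := by
    rw [Measure.prod_apply_symm hmeas]
    refine (lintegral_congr fun q => ?_).trans lintegral_zero
    by_cases hq : q ∈ U
    · refine Set.Finite.measure_zero ((finite_setOf_shifted_mul_eq (pdx (pdx f.1) q)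
        (pdv (pdv f.1) q) (pdv (pdx f.1) q ^ 2)).subset fun s hs => ?_) _
      exact (planarDet_addSMul_quadratic hU f s hq).symm.trans hs.2
    · convert measure_empty (μ := (volume : Measure ℝ))
      exact eq_empty_of_forall_notMem fun s hs => hq hs.1
  exact Measure.measure_ae_null_of_prod_null hnull

/-- Integrable parts all of whose circles of fixed points are transverse and normally hyperbolic or
normally elliptic. -/
def nondegenerateSystems (U : Set Base) : Set (SmoothOn U) :=
  {f | ∀ q ∈ U, grad f.1 q = 0 → planarDet f.1 q ≠ 0 ∧ IsTransverse f.1 q}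

/-- A differentiable map between spaces of equal dimension sends null sets to null sets, and its
critical values are null by Sard. Subtracting the linear form of a `p` outside both images turns
zeros into points with gradient `p`, with second derivatives unchanged. -/
theorem mem_closure_nondegenerateSystems (hU : IsOpen U) {f : SmoothOn U}
    (hf : volume {q : Base | q ∈ U ∧ planarDet f.1 q = 0} = 0) :
    f ∈ closure (nondegenerateSystems U) := by
  have := isAddHaarMeasure_volume_base
  have h1 : volume (grad f.1 '' {q | q ∈ U ∧ planarDet f.1 q = 0}) = 0 :=
    addHaar_image_eq_zero_of_differentiableOn_of_addHaar_eq_zero volume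
      (fun q hq => (hasFDerivAt_grad hU f hq.1).differentiableAt.differentiableWithinAt) hf
  have h2 : volume (grad f.1 '' {q | q ∈ U ∧ (gradDeriv f.1 q).det = 0}) = 0 :=
    addHaar_image_eq_zero_of_det_fderivWithin_eq_zero volume
      (fun q hq => (hasFDerivAt_grad hU f hq.1).hasFDerivWithinAt) fun q hq => hq.2
  have hae := (measure_eq_zero_iff_ae_notMem.1 h1).and (measure_eq_zero_iff_ae_notMem.1 h2)
  have hd := Measure.dense_of_ae hae
  have hcont : Continuous fun p : Base => addLinear f (-p) :=
    (continuous_addLinear hU f).comp continuous_neg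
  have h := map_mem_closure (t := nondegenerateSystems U) hcont (hd 0) fun p hp q hq hg => by
    rw [grad_addLinear hU f (-p) hq, ← sub_eq_add_neg, sub_eq_zero] at hg
    rw [planarDet_addLinear hU f _ hq, isTransverse_addLinear_iff hU f _ hq,
      isTransverse_iff_det_ne_zero]
    exact ⟨fun h => hp.1 ⟨q, ⟨hq, h⟩, hg⟩, fun h => hp.2 ⟨q, ⟨hq, h⟩, hg⟩⟩
  simpa [addLinear_zero] using h

theorem dense_nondegenerateSystems (hU : IsOpen U) : Dense (nondegenerateSystems U) := by
  intro f
  have hcont : Continuous fun s : ℝ => f.addSMul s (quadratic 1 1 0 0) :=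
    (SmoothOn.continuous_addSMul hU _).comp (continuous_const.prodMk continuous_id)
  have h := map_mem_closure (t := closure (nondegenerateSystems U)) hcont
    (Measure.dense_of_ae (ae_volume_planarDet_eq_zero hU f) 0)
    fun s hs => mem_closure_nondegenerateSystems hU hs
  simpa [SmoothOn.addSMul_zero] using h

/-- The function `cos θ`. -/
def cosAngle (W : Set (Base × ℝ × ℝ)) : SmoothOn W :=
  ⟨fun z => Real.cos z.2.1, ContDiff.contDiffOn (by fun_prop)⟩

/-- The perturbation `H₁ + δ cos θ`. -/
def Perturbation.addCos (h : Perturbation U ε₀) (δ : ℝ) : Perturbation U ε₀ :=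
  ⟨h.1.addSMul δ (cosAngle _), fun q hq θ ε hε => by
    simp [SmoothOn.addSMul, cosAngle, h.2 q hq θ ε hε]⟩

theorem Perturbation.addCos_zero (h : Perturbation U ε₀) : h.addCos 0 = h :=
  Subtype.ext (SmoothOn.addSMul_zero _ _)

theorem Perturbation.continuous_addCos (hU : IsOpen U) (h : Perturbation U ε₀) :
    Continuous h.addCos :=
  Continuous.subtype_mk ((SmoothOn.continuous_addSMul (isOpen_perturbationDomain hU) _).comp
    (continuous_const.prodMk continuous_id)) _

/-- At `θ = π / 2` the term `δ cos θ` has derivative `-δ`, so each point `q` excludes at most one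
value of `δ`. -/
theorem Perturbation.exists_fderiv_addCos_ne_zero (hU : IsOpen U) (hε₀ : 0 < ε₀)
    (h : Perturbation U ε₀) {q : Base} (hq : q ∈ U) {δ : ℝ}
    (hδ : δ ≠ fderiv ℝ h.1.1 (q, Real.pi / 2, 0) (0, 1, 0)) :
    ∃ θ : ℝ, fderiv ℝ (h.addCos δ).1.1 (q, θ, 0) (0, 1, 0) ≠ 0 := by
  refine ⟨Real.pi / 2, fun h0 => hδ ?_⟩
  have hmem := mem_perturbationDomain hε₀ hq (Real.pi / 2)
  have h1 := SmoothOn.fderiv_addSMul (isOpen_perturbationDomain hU) h.1 δ (cosAngle _) hmem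
  have hθ : HasFDerivAt (fun z : Base × ℝ × ℝ => z.2.1)
      ((ContinuousLinearMap.fst ℝ ℝ ℝ).comp (ContinuousLinearMap.snd ℝ Base (ℝ × ℝ)))
      (q, Real.pi / 2, 0) := hasFDerivAt_fst.comp _ hasFDerivAt_snd
  have h2 : fderiv ℝ (cosAngle (U ×ˢ (univ : Set ℝ) ×ˢ Ioo (-ε₀) ε₀)).1 (q, Real.pi / 2, 0)
      (0, 1, 0) = -1 := by
    refine (DFunLike.congr_fun hθ.cos.fderiv _).trans ?_
    simp
  have h3 : fderiv ℝ (h.addCos δ).1.1 (q, Real.pi / 2, 0) (0, 1, 0) =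
      fderiv ℝ h.1.1 (q, Real.pi / 2, 0) (0, 1, 0) + δ * fderiv ℝ (cosAngle _).1
        (q, Real.pi / 2, 0) (0, 1, 0) := DFunLike.congr_fun h1 _
  rw [h2, h0] at h3
  linarith

/-- An invertible derivative isolates each zero, and a discrete subset of a hereditarily Lindelöf
space is countable. -/
theorem countable_setOf_grad_eq_zero (hU : IsOpen U) {f : SmoothOn U}
    (hf : f ∈ nondegenerateSystems U) : {q : Base | q ∈ U ∧ grad f.1 q = 0}.Countable := by
  refine (HereditarilyLindelofSpace.isLindelof _).countable_of_isDiscrete ?_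
  rw [isDiscrete_iff_nhdsNE]
  rintro q ⟨hq, hg⟩
  have hdet := (isTransverse_iff_det_ne_zero _ _).1 (hf q hq hg).2
  have h := (hasFDerivAt_grad hU f hq).eventually_ne (c := 0)
    ⟨_, ((gradDeriv f.1 q).toContinuousLinearEquivOfDetNeZero hdet).antilipschitz⟩
  rw [← disjoint_iff, disjoint_principal_right]
  filter_upwards [h] with x hx hx'
  exact hx hx'.2

/-- Once the integrable part is nondegenerate, its countably many circles exclude only countably
many `δ`, so admissible `δ` accumulate at 0. -/
theorem dense_onlySimpleResonances (hU : IsOpen U) (hε₀ : 0 < ε₀) {K : Set Base} (hKU : K ⊆ U) :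
    Dense {N : NearIntegrable U ε₀ | OnlySimpleResonances K N} := by
  rintro ⟨f, h⟩
  rw [← closure_closure]
  refine map_mem_closure (f := fun g : SmoothOn U => (g, h)) (by fun_prop)
    (dense_nondegenerateSystems hU f) fun g hg => ?_
  have hcount := (countable_setOf_grad_eq_zero hU hg).image
    fun q => fderiv ℝ h.1.1 (q, Real.pi / 2, 0) (0, 1, 0)
  have hcl := map_mem_closure (f := fun δ => ((g, h.addCos δ) : NearIntegrable U ε₀))
    (t := {N : NearIntegrable U ε₀ | OnlySimpleResonances K N})
    (continuous_const.prodMk (h.continuous_addCos hU)) (hcount.dense_compl ℝ 0)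
    fun δ hδ => (onlySimpleResonances_iff hU hε₀ hKU _).2 fun q hq hgq =>
      ⟨hg q (hKU hq) hgq, h.exists_fderiv_addCos_ne_zero hU hε₀ (hKU hq)
        fun he => hδ ⟨q, ⟨hKU hq, hgq⟩, he.symm⟩⟩
  rwa [h.addCos_zero] at hcl

end Resonance

namespace Resonance

/-! ### Existence of robust resonances -/

variable {U : Set Base} {ε₀ : ℝ}

/-- Integrable parts with a transverse circle of fixed points of the type given by the sign `σ` of
the planar Hessian determinant. -/
def systemsWithTransverseCircle (σ : ℝ) (U : Set Base) : Set (SmoothOn U) :=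
  {f | ∃ q ∈ U, grad f.1 q = 0 ∧ 0 < σ * planarDet f.1 q ∧ IsTransverse f.1 q}

theorem grad_quadratic_self (a b c : ℝ) (q₀ : Base) :
    grad (quadratic (U := U) a b c q₀).1 q₀ = 0 := by
  simp [grad, pdx, pdv, pdD, fderiv_quadratic]

theorem planarDet_quadratic (a b c : ℝ) (q₀ q : Base) :
    planarDet (quadratic (U := U) a b c q₀).1 q = a * b := by
  have h := fderiv_fderiv_quadratic (U := U) a b c q₀ q
  have hxx : pdx (pdx (quadratic (U := U) a b c q₀).1) q = a := (h _ _).trans (by simp)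
  have hvv : pdv (pdv (quadratic (U := U) a b c q₀).1) q = b := (h _ _).trans (by simp)
  have hvx : pdv (pdx (quadratic (U := U) a b c q₀).1) q = 0 := (h _ _).trans (by simp)
  rw [planarDet, hxx, hvv, hvx]
  ring

theorem isTransverse_quadratic {a b c : ℝ} (ha : a ≠ 0) (hb : b ≠ 0) (hc : c ≠ 0) (q₀ q : Base) :
    IsTransverse (quadratic (U := U) a b c q₀).1 q := by
  have h := fderiv_fderiv_quadratic (U := U) a b c q₀ q
  rw [IsTransverse, Fintype.linearIndependent_iff]
  intro l hl
  have hx : ∀ u, fderiv ℝ (pdx (quadratic (U := U) a b c q₀).1) q u = a * u.1 :=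
    fun u => (h _ _).trans (by simp)
  have hv : ∀ u, fderiv ℝ (pdv (quadratic (U := U) a b c q₀).1) q u = b * u.2.1 :=
    fun u => (h _ _).trans (by simp)
  have hD : ∀ u, fderiv ℝ (pdD (quadratic (U := U) a b c q₀).1) q u = c * u.2.2 :=
    fun u => (h _ _).trans (by simp)
  have hu := fun u : Base => DFunLike.congr_fun hl u
  have h0 := hu (1, 0, 0)
  have h1 := hu (0, 1, 0)
  have h2 := hu (0, 0, 1)
  simp [Fin.sum_univ_three, hx, hv, hD, ha] at h0
  simp [Fin.sum_univ_three, hx, hv, hD, hb] at h1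
  simp [Fin.sum_univ_three, hx, hv, hD, hc] at h2
  intro i
  fin_cases i <;> assumption

/-- The nondegeneracy conditions at `q` depend only on the germ of the function. -/
theorem conditions_of_eventuallyEq {H H' : Base → ℝ} {q : Base} (h : H =ᶠ[𝓝 q] H') {σ : ℝ}
    (hH : grad H' q = 0 ∧ 0 < σ * planarDet H' q ∧ IsTransverse H' q) :
    grad H q = 0 ∧ 0 < σ * planarDet H q ∧ IsTransverse H q := by
  have h1 : ∀ w : Base, (fun y => fderiv ℝ H y w) =ᶠ[𝓝 q] fun y => fderiv ℝ H' y w := fun w =>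
    h.fderiv.mono fun y hy => DFunLike.congr_fun hy w
  have hx : pdx H =ᶠ[𝓝 q] pdx H' := h1 _
  have hv : pdv H =ᶠ[𝓝 q] pdv H' := h1 _
  have hD : pdD H =ᶠ[𝓝 q] pdD H' := h1 _
  have hg : grad H q = grad H' q := by rw [grad, hx.eq_of_nhds, hv.eq_of_nhds, hD.eq_of_nhds, grad]
  have hd : planarDet H q = planarDet H' q := by
    simp only [planarDet, pdx, pdv] at hx hv ⊢
    rw [hx.fderiv_eq, hv.fderiv_eq]
  have ht : IsTransverse H q ↔ IsTransverse H' q := by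
    rw [IsTransverse, hx.fderiv_eq, hv.fderiv_eq, hD.fderiv_eq, IsTransverse]
  rwa [hg, hd, ht]

/-- With `σ` as the coefficient in `v`, the planar determinant is `σ`, and `σ * σ > 0`. -/
theorem conditions_quadratic {σ : ℝ} (hσ : σ ≠ 0) (q : Base) :
    grad (quadratic (U := U) 1 σ 1 q).1 q = 0 ∧
      0 < σ * planarDet (quadratic (U := U) 1 σ 1 q).1 q ∧
      IsTransverse (quadratic (U := U) 1 σ 1 q).1 q := by
  refine ⟨grad_quadratic_self _ _ _ q, ?_, isTransverse_quadratic one_ne_zero hσ one_ne_zero q q⟩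
  rw [planarDet_quadratic, one_mul]
  exact mul_self_pos.2 hσ

/-- Otherwise `U = K` would be clopen and non-empty, hence the whole space, which is not compact. -/
theorem sdiff_nonempty_of_isCompact (hU : IsOpen U) (hne : U.Nonempty) {K : Set Base}
    (hK : IsCompact K) (hKU : K ⊆ U) : (U \ K).Nonempty := by
  rw [Set.nonempty_iff_ne_empty]
  intro h
  have hUK : U = K := Subset.antisymm (Set.sdiff_eq_empty.1 h) hKU
  have huniv := IsClopen.eq_univ ⟨hUK ▸ hK.isClosed, hU⟩ hne
  exact noncompact_univ Base (huniv ▸ hUK ▸ hK)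

theorem dense_systemsWithTransverseCircle (hU : IsOpen U) (hne : U.Nonempty) {σ : ℝ}
    (hσ : σ ≠ 0) : Dense (systemsWithTransverseCircle σ U) := by
  intro f
  refine SmoothOn.mem_closure_of_forall_isCompact fun K hK hKU => ?_
  obtain ⟨q, hq⟩ := sdiff_nonempty_of_isCompact hU hne hK hKU
  obtain ⟨r, hr, hrs⟩ := Metric.nhds_basis_closedBall.mem_iff.1
    ((hU.sdiff hK.isClosed).mem_nhds hq)
  -- The bump equals 1 near `q`, where the glued function is the model, and vanishes off a ball
  -- disjoint from `K`, where it is `f`.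
  let χ : ContDiffBump q := ⟨r / 2, r, half_pos hr, half_lt_self hr⟩
  let m : SmoothOn U := quadratic 1 σ 1 q
  have hχ : ContDiff ℝ ∞ χ := χ.contDiff
  refine ⟨⟨fun x => f.1 x + χ x * (m.1 x - f.1 x),
    f.2.add (hχ.contDiffOn.mul (m.2.sub f.2))⟩, ⟨q, hq.1, ?_⟩, fun x hx => ?_⟩
  · refine conditions_of_eventuallyEq ?_ (conditions_quadratic (U := U) hσ q)
    filter_upwards [χ.eventuallyEq_one] with x hx
    rw [hx, Pi.one_apply, one_mul, add_sub_cancel]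
  · have hxr : x ∈ (Metric.closedBall q r)ᶜ := fun h => (hrs h).2 hx
    filter_upwards [Metric.isClosed_closedBall.isOpen_compl.mem_nhds hxr] with y hy
    have hχy : χ y = 0 := χ.zero_of_le_dist (not_le.1 fun h => hy h).le
    rw [hχy, zero_mul, add_zero]

/-- Interior points come from persistence: a system with a transverse resonance has a whole
neighbourhood of systems with a resonance of the same sign. -/
theorem occursGenerically_isResonanceOfSign (hU : IsOpen U) (hne : U.Nonempty) (hε₀ : 0 < ε₀)
    {σ : ℝ} (hσ : σ ≠ 0) :
    OccursGenerically U ε₀ (IsResonanceOfSign σ) := by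
  refine ⟨?_, ?_, fun N q h ht W hW => h.eventually hU hε₀ ht hW⟩
  · rintro ⟨f, h⟩
    rw [← closure_closure]
    refine map_mem_closure (f := fun g : SmoothOn U => (g, h)) (by fun_prop)
      (dense_systemsWithTransverseCircle hU hne hσ f) ?_
    rintro g ⟨q, hq, hg, hd, ht⟩
    have hcl := map_mem_closure (f := fun δ => ((g, h.addCos δ) : NearIntegrable U ε₀))
      (t := interior {N : NearIntegrable U ε₀ | ∃ q, IsResonanceOfSign σ N q})
      (continuous_const.prodMk (h.continuous_addCos hU))
      ((Set.countable_singleton (fderiv ℝ h.1.1 (q, Real.pi / 2, 0) (0, 1, 0))).dense_compl ℝ 0)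
      fun δ hδ => by
        have hR : IsResonanceOfSign σ ((g, h.addCos δ) : NearIntegrable U ε₀) q :=
          ⟨hq, hg, hd, h.exists_fderiv_addCos_ne_zero hU hε₀ hq hδ⟩
        obtain ⟨V, -, -, hV⟩ := hR.eventually hU hε₀ ht univ_mem
        exact mem_interior_iff_mem_nhds.2 (hV.mono fun N' ⟨q', _, h', _⟩ => ⟨q', h'⟩)
    rwa [h.addCos_zero] at hcl
  · rintro V hV ⟨q, hqV, hq⟩
    let z : Perturbation U ε₀ := ⟨⟨fun _ => 0, contDiffOn_const⟩, fun _ _ _ _ _ => rfl⟩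
    obtain ⟨δ, hδ⟩ := exists_ne (fderiv ℝ z.1.1 (q, Real.pi / 2, 0) (0, 1, 0))
    obtain ⟨hg, hd, ht⟩ := conditions_quadratic (U := U) hσ q
    have hR : IsResonanceOfSign σ ((quadratic 1 σ 1 q, z.addCos δ) : NearIntegrable U ε₀) q :=
      ⟨hq, hg, hd, z.exists_fderiv_addCos_ne_zero hU hε₀ hq hδ⟩
    obtain ⟨V', -, hV', hev⟩ := hR.eventually hU hε₀ ht (hV.mem_nhds hqV)
    exact ⟨_, mem_interior_iff_mem_nhds.2 (hev.mono fun N' ⟨q', hq', h', _⟩ => ⟨q', hV' hq', h'⟩)⟩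

end Resonance

end

theorem corollary2 (U : Set Resonance.Base) (hU : IsOpen U) (hne : U.Nonempty)
    (ε₀ : ℝ) (hε₀ : 0 < ε₀) :
    (∀ K : Set Resonance.Base, IsCompact K → K ⊆ U →
      IsOpen {N : Resonance.NearIntegrable U ε₀ | Resonance.OnlySimpleResonances K N} ∧
      Dense {N : Resonance.NearIntegrable U ε₀ | Resonance.OnlySimpleResonances K N}) ∧
    Resonance.OccursGenerically U ε₀ Resonance.NearIntegrable.IsHyperbolicResonance ∧
    Resonance.OccursGenerically U ε₀ Resonance.NearIntegrable.IsEllipticResonance := by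
  refine ⟨fun K hK hKU => ⟨Resonance.isOpen_onlySimpleResonances hU hε₀ hK hKU,
    Resonance.dense_onlySimpleResonances hU hε₀ hKU⟩, ?_, ?_⟩
  · have h : (Resonance.NearIntegrable.IsHyperbolicResonance (U := U) (ε₀ := ε₀)) =
        Resonance.IsResonanceOfSign (-1) :=
      funext₂ fun N q => propext (Resonance.isHyperbolicResonance_iff hU hε₀ N q)
    rw [h]
    exact Resonance.occursGenerically_isResonanceOfSign hU hne hε₀ (by norm_num)
  · have h : (Resonance.NearIntegrable.IsEllipticResonance (U := U) (ε₀ := ε₀)) =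
        Resonance.IsResonanceOfSign 1 :=
      funext₂ fun N q => propext (Resonance.isEllipticResonance_iff hU hε₀ N q)
    rw [h]
    exact Resonance.occursGenerically_isResonanceOfSign hU hne hε₀ one_ne_zero
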